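/- Let $k$ be a field and let $\mathcal G$ be an affine gerbe over $k$, that is, a gerbe over the category of $k$-schemes for the fpqc topology (a stack in groupoids which locally has objects, and any two objects of which over the same scheme are locally isomorphic) that has an affine chart (an affine, faithfully flat morphism $U\to\mathcal G$ with $U$ an affine $k$-scheme) and an affine diagonal. Let $\phi:\mathcal G\to\operatorname{Spec} k$ be the structural morphism and let $I_{\mathcal G}=\mathcal G\times_{\mathcal G\times_k\mathcal G}\mathcal G$ be the inertia stack, a group scheme over $\mathcal G$ whose sections over an object $\xi\in\mathcal G(T)$ are the automorphisms of $\xi$ in $\mathcal G(T)$. Call $\mathcal G$ abelian if there are a field extension $k'/k$ and an object $\xi\in\mathcal G(k')$ such that the $k'$-group scheme $\operatorname{Aut}_{k'}(\xi)$ is abelian. Then $\mathcal G$ is abelian if and only if $I_{\mathcal G}$ descends along $\phi$ as a group scheme to $\operatorname{Spec} k$, i.e. if and only if there exist an affine group scheme $G$ over $k$ (not assumed to be abelian) and an isomorphism $\mathcal G\times_{\operatorname{Spec} k} G\simeq I_{\mathcal G}$ of group schemes over $\mathcal G$. -/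

import Mathlib

open CategoryTheory AlgebraicGeometry Opposite Bicategory

universe u w

namespace AffGerbe

noncomputable section

/-- The category of schemes over the field `k`. -/
abbrev Sch (k : Type u) [Field k] : Type (u + 1) := Over (Spec (CommRingCat.of k))

/-- The fpqc topology on the category of schemes over `k`. -/
abbrev fpqc (k : Type u) [Field k] : GrothendieckTopology (Sch k) :=
  Scheme.fpqcTopology.over (Spec (CommRingCat.of k))

/-- The spectrum of an extension `K` of `k`, as a scheme over `k`. -/
abbrev specExt (k : Type u) [Field k] (K : Type u) [Field K] [Algebra k K] : Sch k :=
  Over.mk (Spec.map (CommRingCat.ofHom (algebraMap k K)))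

/-- A fibered category over the schemes over `k` with chosen pullbacks: a contravariant
pseudofunctor to categories. -/
abbrev FibCat (k : Type u) [Field k] := LocallyDiscrete (Sch k)ᵒᵖ ⥤ᵖ Cat.{u, w}

variable {k : Type u} [Field k] (F : FibCat.{u, w} k)

/-- The fibre category `F(T)`. -/
abbrev Fib (T : Sch k) : Type w := F.obj (LocallyDiscrete.mk (op T))

variable {F} in
/-- The pullback `f^* ξ` of an object `ξ` of `F(T)` along `f : T' ⟶ T`. -/
abbrev pull {T' T : Sch k} (f : T' ⟶ T) (ξ : Fib F T) : Fib F T' :=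
  (F.map f.op.toLoc).toFunctor.obj ξ

/-- All the fibre categories are groupoids. -/
class IsFiberedInGroupoids : Prop where
  isGroupoid (T : Sch k) : IsGroupoid (Fib F T)

instance [IsFiberedInGroupoids F] (T : Sch k) : IsGroupoid (Fib F T) :=
  IsFiberedInGroupoids.isGroupoid T

/-- An fpqc gerbe over `k`: a stack in groupoids for the fpqc topology which locally has objects
and any two objects of which are locally isomorphic. -/
class IsGerbe : Prop extends IsFiberedInGroupoids F where
  isStack : F.IsStack (fpqc k)
  locally_nonempty (T : Sch k) :
    ∃ R ∈ fpqc k T, ∀ ⦃U : Sch k⦄ (f : U ⟶ T), R f → Nonempty (Fib F U)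
  locally_isomorphic (T : Sch k) (ξ η : Fib F T) :
    ∃ R ∈ fpqc k T, ∀ ⦃U : Sch k⦄ (f : U ⟶ T), R f → Nonempty (pull f ξ ≅ pull f η)

/-- The diagonal `F ⟶ F × F` is representable and affine: for objects `ξ`, `η` over the same
scheme `T`, the functor of (iso)morphisms from `ξ` to `η`, on schemes over `T`, is represented by a
scheme which is affine over `T`. -/
def HasAffineDiagonal : Prop :=
  ∀ (T : Sch k) (ξ η : Fib F T), ∃ I : Over T,
    IsAffineHom I.hom.left ∧ Nonempty ((F.presheafHom ξ η).RepresentableBy I)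

variable {F} in
/-- Given objects `ξ` of `F(U)` and `η` of `F(T)`, corresponding to morphisms `U ⟶ F` and `T ⟶ F`,
the scheme `R` with its two projections and the morphism `θ` represents the fibre product of
`U` and `T` over `F`. -/
def IsFibreProduct {U T : Sch k} (ξ : Fib F U) (η : Fib F T) {R : Sch k} (p : R ⟶ U) (q : R ⟶ T)
    (θ : pull p ξ ⟶ pull q η) : Prop :=
  ∀ (V : Sch k) (a : V ⟶ U) (b : V ⟶ T) (φ : pull a ξ ⟶ pull b η),
    ∃! g : V ⟶ R, ∃ (ha : g ≫ p = a) (hb : g ≫ q = b),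
      Pseudofunctor.LocallyDiscreteOpToCat.pullHom θ g a b ha hb = φ

/-- There is an affine scheme `U` over `k` and an affine, faithfully flat morphism `U ⟶ F`, given
by an object `ξ` of `F(U)`: its base change along any morphism `T ⟶ F` from a scheme is a scheme
which is affine and faithfully flat over `T`. -/
def HasAffineChart : Prop :=
  ∃ (U : Sch k) (ξ : Fib F U), IsAffine U.left ∧
    ∀ (T : Sch k) (η : Fib F T), ∃ (R : Sch k) (p : R ⟶ U) (q : R ⟶ T)
      (θ : pull p ξ ⟶ pull q η), IsFibreProduct ξ η p q θ ∧
        IsAffineHom q.left ∧ Flat q.left ∧ Surjective q.left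

/-- An affine gerbe over `k`: an fpqc gerbe with an affine chart and an affine diagonal. -/
class IsAffineGerbe : Prop extends IsGerbe F where
  hasAffineChart : HasAffineChart F
  hasAffineDiagonal : HasAffineDiagonal F

variable {F} in
/-- The group scheme (a priori group functor) `Aut_T(ξ)` over `T`, whose sections over
`f : T' ⟶ T` are the automorphisms of `f^* ξ`, is abelian. -/
def IsAbelianAut {T : Sch k} (ξ : Fib F T) : Prop :=
  ∀ ⦃T' : Sch k⦄ (f : T' ⟶ T) (a b : Aut (pull f ξ)), a * b = b * a

/-- A gerbe is abelian if there is an extension `K` of `k` and an object of `F(K)` whose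
automorphism group scheme is abelian. -/
def IsAbelian : Prop :=
  ∃ (K : Type u) (_ : Field K) (_ : Algebra k K) (ξ : Fib F (specExt k K)), IsAbelianAut ξ

/-- The restriction morphism `Aut Y.fiber → Aut X.fiber` along a morphism `f : X ⟶ Y` in the total
category of `F`, lying over `X.base ⟶ Y.base`: pull back to `X.base`, then
transport along the isomorphism of `X.fiber` with the pullback of `Y.fiber`. -/
def autRestrict [IsFiberedInGroupoids F] {X Y : F.CoGrothendieck} (f : X ⟶ Y) :
    Aut Y.fiber →* Aut X.fiber where
  toFun α := asIso f.fiber ≪≫ (F.map f.base.op.toLoc).toFunctor.mapIso α ≪≫ (asIso f.fiber).symm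
  map_one' := by
    apply Iso.ext
    change f.fiber ≫ (F.map f.base.op.toLoc).toFunctor.map (𝟙 _) ≫ inv f.fiber = 𝟙 _
    simp
  map_mul' α β := by
    apply Iso.ext
    change f.fiber ≫ (F.map f.base.op.toLoc).toFunctor.map (β.hom ≫ α.hom) ≫ inv f.fiber =
      (f.fiber ≫ (F.map f.base.op.toLoc).toFunctor.map β.hom ≫ inv f.fiber) ≫
        (f.fiber ≫ (F.map f.base.op.toLoc).toFunctor.map α.hom ≫ inv f.fiber)
    simp

variable {F}

lemma autRestrict_hom_comp [IsFiberedInGroupoids F] {X Y : F.CoGrothendieck} (f : X ⟶ Y)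
    (α : Aut Y.fiber) :
    (autRestrict F f α).hom ≫ f.fiber =
      f.fiber ≫ (F.map f.base.op.toLoc).toFunctor.map α.hom := by
  change (f.fiber ≫ (F.map f.base.op.toLoc).toFunctor.map α.hom ≫ inv f.fiber) ≫ f.fiber = _
  simp

lemma autRestrict_unique [IsFiberedInGroupoids F] {X Y : F.CoGrothendieck} (f : X ⟶ Y)
    (α : Aut Y.fiber) (β : Aut X.fiber)
    (h : β.hom ≫ f.fiber = f.fiber ≫ (F.map f.base.op.toLoc).toFunctor.map α.hom) :
    autRestrict F f α = β := by
  apply Iso.ext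
  rw [← cancel_mono f.fiber, h, autRestrict_hom_comp]

lemma autRestrict_id [IsFiberedInGroupoids F] (X : F.CoGrothendieck) (α : Aut X.fiber) :
    autRestrict F (𝟙 X) α = α :=
  autRestrict_unique _ _ _ ((F.mapId ⟨op X.base⟩).inv.toNatTrans.naturality α.hom)

lemma autRestrict_comp [IsFiberedInGroupoids F] {X Y Z : F.CoGrothendieck} (f : X ⟶ Y)
    (g : Y ⟶ Z) (α : Aut Z.fiber) :
    autRestrict F (f ≫ g) α = autRestrict F f (autRestrict F g α) := by
  refine autRestrict_unique _ _ _ ?_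
  have key : ∀ {C : Type w} [Category.{u} C] {A B D E : C} {f : A ⟶ B} {g : B ⟶ D} {c : D ⟶ E}
      {r : A ⟶ A} {a : B ⟶ B} {b : D ⟶ D} {d : E ⟶ E}, r ≫ f = f ≫ a → a ≫ g = g ≫ b →
      b ≫ c = c ≫ d → r ≫ f ≫ g ≫ c = (f ≫ g ≫ c) ≫ d := by
    intro C _ A B D E f g c r a b d h₁ h₂ h₃
    rw [reassoc_of% h₁, reassoc_of% h₂, h₃]
    simp only [Category.assoc]
  have h := congrArg (F.map f.base.op.toLoc).toFunctor.map (autRestrict_hom_comp g α)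
  rw [Functor.map_comp, Functor.map_comp] at h
  exact key (autRestrict_hom_comp f (autRestrict F g α)) h
    ((F.mapComp g.base.op.toLoc f.base.op.toLoc).inv.toNatTrans.naturality α.hom)

variable (F)

/-- The inertia stack of `F`, as a group over `F`. A stack over `F` whose fibre over each
object `ξ` of `F` is a set is a presheaf (in fact a sheaf) on the total category of `F`, whose
objects are the pairs `(T, ξ)` with `ξ` in `F(T)`. The inertia stack classifies the pairs of an
object `ξ` of `F(T)` and an automorphism of `ξ` in `F(T)`, so it is the presheaf of groups
`(T, ξ) ↦ Aut_T(ξ)`. -/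
def inertia [IsFiberedInGroupoids F] : (F.CoGrothendieck)ᵒᵖ ⥤ GrpCat.{u} where
  obj X := GrpCat.of (Aut X.unop.fiber)
  map f := GrpCat.ofHom (autRestrict F f.unop)
  map_id X := by
    ext α : 2
    exact autRestrict_id X.unop α
  map_comp f g := by
    ext α : 2
    exact autRestrict_comp g.unop f.unop α

/-- The pullback `F ×_k G` to `F` of a group scheme `G` over `k`, as a group over `F`: its
sections over `(T, ξ)` are the points of `G` with values in `T`. -/
def pullbackGroup (G : Sch k) [GrpObj G] : (F.CoGrothendieck)ᵒᵖ ⥤ GrpCat.{u} :=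
  (Pseudofunctor.CoGrothendieck.forget F).op ⋙ yonedaGrpObj G

/-- The inertia stack of `F` descends along `F ⟶ Spec k` as a group scheme: there are an affine
group scheme `G` over `k` and an isomorphism of groups over `F` between `F ×_k G` and the inertia
stack. -/
def InertiaDescends [IsFiberedInGroupoids F] : Prop :=
  ∃ (G : Sch k) (_ : GrpObj G), IsAffine G.left ∧ Nonempty (pullbackGroup F G ≅ inertia F)

end

end AffGerbe

/-! Both directions pass through the condition that `Aut X.fiber` is commutative for every object
`X` of the total category.

Suppose that the inertia is the pullback of some `G`. Then restriction of automorphisms along a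
morphism of the total category depends only on its base. Restriction along a vertical automorphism
`b` is conjugation by `b`, and `b` has the same base as the identity, so conjugation is trivial
(`aut_mul_comm_of_inertiaDescends`). An object over a field exists because a covering of `Spec k`
has a nonempty member, which has a residue field.

Conversely, let `ξ` over `K` have abelian automorphisms. Every object is fpqc-locally isomorphic to
a pullback of `ξ`, so all automorphism groups are commutative. Isomorphisms over the same base then
induce the same map on automorphisms. Hence an automorphism of one object spreads uniquely to all
objects over its base, and the inertia is the pullback of its direct image `band F`
(`bandEval_bijective`). The band is a sheaf (`isSheaf_bandType`); over `K` it is represented by the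
automorphism scheme of `ξ`, affine because the diagonal is. Affine descent along `Spec K ⟶ Spec k`
(`exists_representableBy_of_specExt`) gives `G`. -/

namespace AffGerbe

variable {k : Type u} [Field k] {F : FibCat.{u, w} k}

/-! ### Cartesian morphisms and restriction of automorphisms. -/

noncomputable section Fibered

/-- The pullback of an object of the total category along a morphism to its base. -/
abbrev pullObj (X : F.CoGrothendieck) {U : Sch k} (f : U ⟶ X.base) : F.CoGrothendieck :=
  ⟨U, pull f X.fiber⟩

/-- The cartesian morphism from the pullback of `X` to `X`. -/
abbrev pullMap (X : F.CoGrothendieck) {U : Sch k} (f : U ⟶ X.base) : pullObj X f ⟶ X :=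
  ⟨f, 𝟙 _⟩

/-- In a category fibred in groupoids every morphism is cartesian. This is the existence half;
`hom_ext_of_comp` is the uniqueness half. -/
lemma exists_lift [IsFiberedInGroupoids F] {X Y Z : F.CoGrothendieck} (g : Z ⟶ X) (h : Y ⟶ X)
    (b : Y.base ⟶ Z.base) (hb : b ≫ g.base = h.base) : ∃ c : Y ⟶ Z, c.base = b ∧ c ≫ g = h := by
  obtain ⟨g₁, g₂⟩ := g
  obtain ⟨h₁, h₂⟩ := h
  dsimp only at hb
  subst hb
  refine ⟨⟨b, h₂ ≫ (F.mapComp g₁.op.toLoc b.op.toLoc).hom.toNatTrans.app X.fiber ≫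
    (F.map b.op.toLoc).toFunctor.map (inv g₂)⟩, rfl, ?_⟩
  -- The computation is made in an arbitrary category because the objects in the actual composite
  -- match only up to unfolding. The trailing `𝟙 B` is the transport along `rfl` in the
  -- extensionality lemma.
  have key : ∀ {C : Type w} [Category.{u} C] {A B D E : C} {h : A ⟶ B} {m : B ⟶ D} {n : D ⟶ B}
      {p : D ⟶ E} {q : E ⟶ D}, m ≫ n = 𝟙 B → p ≫ q = 𝟙 D →
      (h ≫ m ≫ p) ≫ q ≫ n = h ≫ 𝟙 B := by
    intro C _ A B D E h m n p q h₁ h₂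
    simp [reassoc_of% h₂, h₁]
  refine Pseudofunctor.CoGrothendieck.Hom.ext _ _ rfl (key
    ((Cat.Hom.toNatIso (F.mapComp g₁.op.toLoc b.op.toLoc)).hom_inv_id_app X.fiber) ?_)
  rw [← Functor.map_comp, IsIso.inv_hom_id]
  exact (F.map b.op.toLoc).toFunctor.map_id _

lemma hom_ext_of_comp [IsFiberedInGroupoids F] {X Y Z : F.CoGrothendieck} (g : Z ⟶ X)
    {c c' : Y ⟶ Z} (hb : c.base = c'.base) (h : c ≫ g = c' ≫ g) : c = c' := by
  obtain ⟨b, φ⟩ := c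
  obtain ⟨b', φ'⟩ := c'
  dsimp only at hb
  subst hb
  have h' := Pseudofunctor.CoGrothendieck.Hom.congr h
  have key : ∀ {C : Type w} [Category.{u} C] {A B D E : C} {φ φ' : A ⟶ B} {p : B ⟶ D}
      {m : D ⟶ E} {n : E ⟶ D}, IsIso p → m ≫ n = 𝟙 D → φ ≫ p ≫ m = (φ' ≫ p ≫ m) ≫ 𝟙 E →
      φ = φ' := by
    intro C _ A B D E φ φ' p m n h₁ h₂ h₃
    have : φ ≫ p ≫ m ≫ n = φ' ≫ p ≫ m ≫ n := by
      simpa using congrArg (· ≫ n) h₃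
    rwa [h₂, Category.comp_id, cancel_mono] at this
  exact congrArg _ (key (p := (F.map b.op.toLoc).toFunctor.map g.fiber) inferInstance
    ((Cat.Hom.toNatIso (F.mapComp g.base.op.toLoc b.op.toLoc)).inv_hom_id_app X.fiber) h')

/-- The canonical morphism between pullbacks of `X` along `f` and along a composite with `f`. -/
def pullComp (X : F.CoGrothendieck) {U V : Sch k} (f : U ⟶ X.base) (g : V ⟶ U)
    (gf : V ⟶ X.base) (h : g ≫ f = gf) : pullObj X gf ⟶ pullObj X f :=
  ⟨g, (F.mapComp' f.op.toLoc g.op.toLoc gf.op.toLoc (by subst h; rfl)).hom.toNatTrans.app X.fiber⟩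

lemma pullComp_comp_pullMap (X : F.CoGrothendieck) {U V : Sch k} (f : U ⟶ X.base) (g : V ⟶ U)
    (gf : V ⟶ X.base) (h : g ≫ f = gf) : pullComp X f g gf h ≫ pullMap X f = pullMap X gf := by
  subst h
  refine Pseudofunctor.CoGrothendieck.Hom.ext _ _ rfl ?_
  have key : ∀ {C : Type w} [Category.{u} C] {A B : C} {m : A ⟶ B} {n : B ⟶ A} {p : B ⟶ B},
      m ≫ n = 𝟙 A → p = 𝟙 B → m ≫ p ≫ n = 𝟙 A ≫ 𝟙 A := by
    intro C _ A B m n p h₁ h₂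
    simp [h₁, h₂]
  refine key ?_ ((F.map g.op.toLoc).toFunctor.map_id _)
  have := (Cat.Hom.toNatIso (F.mapComp f.op.toLoc g.op.toLoc)).hom_inv_id_app X.fiber
  have e := congrArg (fun i ↦ i.hom.toNatTrans.app X.fiber)
    (F.mapComp'_eq_mapComp f.op.toLoc g.op.toLoc)
  exact (congrArg (· ≫ (F.mapComp f.op.toLoc g.op.toLoc).inv.toNatTrans.app X.fiber) e).trans this

variable [IsFiberedInGroupoids F]

/-- Bridge to `presheafHom`, through which the stack condition becomes gluing for `autRestrict`. -/
lemma pullHom_eq_autRestrict (X : F.CoGrothendieck) {U V : Sch k} (f : U ⟶ X.base) (g : V ⟶ U)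
    (gf : V ⟶ X.base) (h : g ≫ f = gf) (α : Aut (pull f X.fiber)) :
    Pseudofunctor.LocallyDiscreteOpToCat.pullHom α.hom g gf gf h h =
      (autRestrict F (pullComp X f g gf h) α).hom := by
  rw [← cancel_mono (pullComp X f g gf h).fiber, autRestrict_hom_comp]
  unfold Pseudofunctor.LocallyDiscreteOpToCat.pullHom
  simp only [Category.assoc, pullComp]
  rw [← Cat.Hom₂.comp_app, Iso.inv_hom_id]
  erw [Category.comp_id]

variable (F) in
-- Morphisms with the same base differ by an automorphism `γ` of the source, so their restrictions
-- differ by conjugation by `γ`.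
lemma autRestrict_eq_conj {X Y : F.CoGrothendieck} {f g : X ⟶ Y} (h : f.base = g.base)
    (hX : ∀ a b : Aut X.fiber, a * b = b * a) (α : Aut Y.fiber) :
    autRestrict F f α = autRestrict F g α := by
  obtain ⟨b, φ⟩ := f
  obtain ⟨b', ψ⟩ := g
  dsimp only at h
  subst h
  refine autRestrict_unique _ _ _ ?_
  let γ : Aut X.fiber := asIso φ ≪≫ (asIso ψ).symm
  have hγ : φ = γ.hom ≫ ψ := by simp [γ]
  have h₁ := autRestrict_hom_comp (F := F) ⟨b, ψ⟩ α
  have h₂ := congrArg Iso.hom (hX (autRestrict F ⟨b, ψ⟩ α) γ)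
  change γ.hom ≫ (autRestrict F ⟨b, ψ⟩ α).hom = (autRestrict F ⟨b, ψ⟩ α).hom ≫ γ.hom at h₂
  dsimp only at h₁ ⊢
  rw [hγ, ← Category.assoc, ← h₂, Category.assoc, Category.assoc, h₁]

end Fibered

/-! ### Fpqc gluing of automorphisms and local morphisms between objects. -/

section Gluing

variable [IsGerbe F]

lemma eq_of_locally_eq (X : F.CoGrothendieck) (R : Sieve X.base) (hR : R ∈ fpqc k X.base)
    (α β : Aut X.fiber)
    (h : ∀ ⦃Z : F.CoGrothendieck⦄ (z : Z ⟶ X), R z.base → autRestrict F z α = autRestrict F z β) :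
    α = β := by
  have : F.IsStack (fpqc k) := IsGerbe.isStack
  have hS := (isSheaf_iff_isSheaf_of_type _ _).1
    (Pseudofunctor.IsPrestack.isSheaf (F := F) (fpqc k) X.fiber X.fiber)
    (X := Over.mk (𝟙 X.base)) _
    (GrothendieckTopology.overEquiv_symm_mem_over _ (Over.mk (𝟙 X.base)) R hR)
  -- Over the final object of `Over X.base`, `presheafHom` gives endomorphisms of the pullback along
  -- `𝟙`; the section `i` of `pullMap` brings statements about it back to `X`.
  obtain ⟨i, hi, hi'⟩ := exists_lift (pullMap X (𝟙 X.base)) (𝟙 X) (𝟙 _) (by simp)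
  have key : autRestrict F (pullMap X (𝟙 X.base)) α = autRestrict F (pullMap X (𝟙 X.base)) β := by
    apply Iso.ext
    refine hS.isSeparatedFor.ext fun T f hf ↦ ?_
    have hf' : R f.left := (Sieve.overEquiv_symm_iff _ _).1 hf
    have e : f.left = T.hom := by simpa using Over.w f
    have := h (pullMap X T.hom) (by simpa [← e] using hf')
    refine (pullHom_eq_autRestrict X (𝟙 X.base) f.left T.hom (Over.w f) _).trans
      (Eq.trans ?_ (pullHom_eq_autRestrict X (𝟙 X.base) f.left T.hom (Over.w f) _).symm)
    rw [← autRestrict_comp, ← autRestrict_comp, pullComp_comp_pullMap, this]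
  rw [← autRestrict_id X α, ← autRestrict_id X β, ← hi', autRestrict_comp, key, autRestrict_comp]

lemma exists_glue (X : F.CoGrothendieck) (R : Sieve X.base) (hR : R ∈ fpqc k X.base)
    (β : ∀ ⦃Z : F.CoGrothendieck⦄ (z : Z ⟶ X), R z.base → Aut Z.fiber)
    (hβ : ∀ ⦃Z' Z : F.CoGrothendieck⦄ (c : Z' ⟶ Z) (z : Z ⟶ X) (hz : R z.base)
      (hz' : R (c ≫ z).base), autRestrict F c (β z hz) = β (c ≫ z) hz') :
    ∃ α : Aut X.fiber, ∀ ⦃Z : F.CoGrothendieck⦄ (z : Z ⟶ X) (hz : R z.base),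
      autRestrict F z α = β z hz := by
  have : F.IsStack (fpqc k) := IsGerbe.isStack
  have hS := (isSheaf_iff_isSheaf_of_type _ _).1
    (Pseudofunctor.IsPrestack.isSheaf (F := F) (fpqc k) X.fiber X.fiber)
    (X := Over.mk (𝟙 X.base)) _
    (GrothendieckTopology.overEquiv_symm_mem_over _ (Over.mk (𝟙 X.base)) R hR)
  have hmem : ∀ ⦃T : Over X.base⦄ (f : T ⟶ Over.mk (𝟙 X.base)),
      (Sieve.overEquiv (Over.mk (𝟙 X.base))).symm R f → R T.hom := by
    intro T f hf
    have hf' : R f.left := (Sieve.overEquiv_symm_iff _ _).1 hf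
    have e : f.left = T.hom := by simpa using Over.w f
    rwa [← e]
  let x : Presieve.FamilyOfElements (F.presheafHom X.fiber X.fiber)
      ((Sieve.overEquiv (Over.mk (𝟙 X.base))).symm R).arrows :=
    fun T f hf ↦ (β (pullMap X T.hom) (hmem f hf)).hom
  have hx : x.Compatible := by
    rw [Presieve.compatible_iff_sieveCompatible]
    intro T T' f g hf
    refine Eq.trans ?_ (pullHom_eq_autRestrict X T.hom g.left T'.hom (Over.w g) _).symm
    refine congrArg Iso.hom ?_
    have hc := pullComp_comp_pullMap X T.hom g.left T'.hom (Over.w g)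
    rw [hβ (pullComp X T.hom g.left T'.hom (Over.w g)) (pullMap X T.hom) (hmem f hf)
      (by rw [hc]; exact hmem _ (Sieve.downward_closed _ hf g))]
    congr 1
    exact hc.symm
  obtain ⟨t, ht, -⟩ := hS x hx
  -- Gluing yields only an endomorphism; it is invertible because the fibre is a groupoid.
  let α' : Aut (pull (𝟙 X.base) X.fiber) := asIso (show pull (𝟙 X.base) X.fiber ⟶ _ from t)
  obtain ⟨i, hi, hi'⟩ := exists_lift (pullMap X (𝟙 X.base)) (𝟙 X) (𝟙 _) (by simp)
  refine ⟨autRestrict F i α', fun Z z hz ↦ ?_⟩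
  let f : Over.mk z.base ⟶ Over.mk (𝟙 X.base) := Over.homMk z.base (by simp)
  have hf : (Sieve.overEquiv (Over.mk (𝟙 X.base))).symm R f := (Sieve.overEquiv_symm_iff _ _).2 hz
  have h₁ : autRestrict F (pullComp X (𝟙 X.base) z.base z.base (by simp)) α' =
      β (pullMap X z.base) hz := by
    apply Iso.ext
    rw [← pullHom_eq_autRestrict]
    exact ht f hf
  obtain ⟨e, he, he'⟩ := exists_lift (pullMap X z.base) z (𝟙 _) (by simp)
  have h₂ := hβ e (pullMap X z.base) hz (by rw [he']; exact hz)
  rw [← h₁, ← autRestrict_comp] at h₂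
  have h₃ : e ≫ pullComp X (𝟙 X.base) z.base z.base (by simp) = z ≫ i := by
    refine hom_ext_of_comp (pullMap X (𝟙 X.base)) ?_ ?_
    · simp [he, hi, pullComp]
    · rw [Category.assoc, pullComp_comp_pullMap, Category.assoc, hi', he', Category.comp_id]
  rw [← autRestrict_comp, ← h₃, h₂]
  congr 1

lemma exists_cover_hom (X Y : F.CoGrothendieck) (f : Y.base ⟶ X.base) :
    ∃ R ∈ fpqc k Y.base, ∀ ⦃Z : F.CoGrothendieck⦄ (z : Z ⟶ Y), R z.base →
      ∃ e : Z ⟶ X, e.base = z.base ≫ f := by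
  obtain ⟨R, hR, h⟩ := IsGerbe.locally_isomorphic Y.base Y.fiber (pull f X.fiber)
  refine ⟨R, hR, fun Z z hz ↦ ?_⟩
  obtain ⟨e⟩ := h z.base hz
  exact ⟨(⟨z.base, z.fiber ≫ e.hom⟩ : Z ⟶ pullObj X f) ≫ pullMap X f, rfl⟩

end Gluing

end AffGerbe

namespace AffGerbe

variable {k : Type u} [Field k] {F : FibCat.{u, w} k}

/-! ### The direct image of the inertia and its comparison with the inertia. -/

noncomputable section Band

variable (F) in
/-- The compatible families of automorphisms of all objects of `F` over schemes over `T`. -/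
def bandSections [IsFiberedInGroupoids F] (T : Sch k) :
    Subgroup (∀ (X : F.CoGrothendieck) (_ : X.base ⟶ T), Aut X.fiber) where
  carrier := {s | ∀ ⦃X Y : F.CoGrothendieck⦄ (g : X ⟶ Y) (f : Y.base ⟶ T),
    autRestrict F g (s Y f) = s X (g.base ≫ f)}
  mul_mem' {s t} hs ht X Y g f := by
    rw [Pi.mul_apply, Pi.mul_apply, map_mul, hs, ht]; rfl
  one_mem' X Y g f := map_one _
  inv_mem' {s} hs X Y g f := by
    rw [Pi.inv_apply, Pi.inv_apply, map_inv, hs]; rfl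

lemma bandSections_ext [IsFiberedInGroupoids F] {T : Sch k} {s t : bandSections F T}
    (h : ∀ (X : F.CoGrothendieck) (f : X.base ⟶ T), s.1 X f = t.1 X f) : s = t :=
  Subtype.ext (funext fun X ↦ funext fun f ↦ h X f)

variable (F) in
/-- The presheaf of groups of compatible families of automorphisms: the direct image of the inertia
stack on the category of schemes over `k`. -/
def band [IsFiberedInGroupoids F] : (Sch k)ᵒᵖ ⥤ GrpCat.{max (u + 1) w} where
  obj T := GrpCat.of (bandSections F T.unop)
  map {T T'} p := GrpCat.ofHom
    { toFun s := ⟨fun X f ↦ s.1 X (f ≫ p.unop), fun X Y g f ↦ by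
        exact (s.2 g (f ≫ p.unop)).trans (congrArg (s.1 X) (Category.assoc _ _ _).symm)⟩
      map_one' := rfl
      map_mul' _ _ := rfl }
  map_id T := by
    exact GrpCat.hom_ext (MonoidHom.ext fun s ↦ bandSections_ext fun X f ↦
      congrArg (s.1 X) (Category.comp_id f))
  map_comp p q := by
    exact GrpCat.hom_ext (MonoidHom.ext fun s ↦ bandSections_ext fun X f ↦
      (congrArg (s.1 X) (Category.assoc f q.unop p.unop)).symm)

variable (F) in
/-- The underlying presheaf of sets of the band. -/
abbrev bandType [IsFiberedInGroupoids F] : (Sch k)ᵒᵖ ⥤ Type (max (u + 1) w) :=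
  band F ⋙ forget GrpCat

/-- The component of a section of the band at an object. -/
def bandEval [IsFiberedInGroupoids F] {T : Sch k} (s : (bandType F).obj (op T))
    (X : F.CoGrothendieck) (f : X.base ⟶ T) : Aut X.fiber :=
  (show bandSections F T from s).1 X f

section

variable [IsFiberedInGroupoids F] {T : Sch k}

lemma autRestrict_bandEval (s : (bandType F).obj (op T)) {X Y : F.CoGrothendieck} (g : X ⟶ Y)
    (f : Y.base ⟶ T) : autRestrict F g (bandEval s Y f) = bandEval s X (g.base ≫ f) :=
  (show bandSections F T from s).2 g f

lemma bandEval_map (s : (bandType F).obj (op T)) {T' : Sch k} (p : T' ⟶ T)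
    (X : F.CoGrothendieck) (f : X.base ⟶ T') :
    bandEval ((bandType F).map p.op s) X f = bandEval s X (f ≫ p) := rfl

lemma band_ext {s t : (bandType F).obj (op T)}
    (h : ∀ (X : F.CoGrothendieck) (f : X.base ⟶ T), bandEval s X f = bandEval t X f) : s = t :=
  bandSections_ext h

end

variable [IsGerbe F]

variable (F) in
lemma isSheaf_bandType : Presieve.IsSheaf (fpqc k) (bandType F) := by
  intro T R hR x hx
  rw [Presieve.compatible_iff_sieveCompatible] at hx
  -- The value at `X` is forced on each `Z` whose base lies in the sieve: there it is the value at
  -- `Z` of the given local section over `Z.base`.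
  have hglue : ∀ (X : F.CoGrothendieck) (h : X.base ⟶ T), ∃ α : Aut X.fiber,
      ∀ ⦃Z : F.CoGrothendieck⦄ (z : Z ⟶ X) (hz : R (z.base ≫ h)),
        autRestrict F z α = bandEval (x (z.base ≫ h) hz) Z (𝟙 _) := by
    intro X h
    refine exists_glue X (R.pullback h) (GrothendieckTopology.pullback_stable _ h hR)
      (fun Z z hz ↦ bandEval (x (z.base ≫ h) hz) Z (𝟙 _)) fun Z' Z c z hz hz' ↦ ?_
    rw [autRestrict_bandEval]
    have e := hx (z.base ≫ h) c.base hz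
    have e' : x (c.base ≫ z.base ≫ h) (R.downward_closed hz c.base) ≍
        x ((c ≫ z).base ≫ h) hz' := by
      congr 1
    have e₂ := eq_of_heq e'
    rw [← e₂, e, bandEval_map, Category.comp_id, Category.id_comp]
  choose a ha using hglue
  let s : bandSections F T := ⟨fun X h ↦ a X h, fun X Y g f ↦ by
    refine eq_of_locally_eq X _ (GrothendieckTopology.pullback_stable _ (g.base ≫ f) hR) _ _
      fun Z z hz ↦ ?_
    have hz' : R ((z ≫ g).base ≫ f) := by
      rw [Pseudofunctor.CoGrothendieck.categoryStruct_comp_base, Category.assoc]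
      exact hz
    rw [← autRestrict_comp, ha Y f (z ≫ g) hz', ha X (g.base ≫ f) z hz]
    have e : (z ≫ g).base ≫ f = z.base ≫ g.base ≫ f := Category.assoc _ _ _
    congr 2⟩
  refine ⟨s, fun U f hf ↦ band_ext fun X h ↦ ?_, fun t ht ↦ band_ext fun X h ↦ ?_⟩
  · have e := ha X (h ≫ f) (𝟙 X) (R.downward_closed (R.downward_closed hf h) _)
    rw [autRestrict_id] at e
    refine e.trans ?_
    have e₂ : x ((𝟙 X : X ⟶ X).base ≫ h ≫ f) (R.downward_closed (R.downward_closed hf h) _) =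
        x (h ≫ f) (R.downward_closed hf h) := by
      congr 1
    rw [e₂, hx f h hf, bandEval_map, Category.id_comp]
  · refine eq_of_locally_eq X _ (GrothendieckTopology.pullback_stable _ h hR) _ _
      fun Z z hz ↦ ?_
    refine Eq.trans ?_ (ha X h z hz).symm
    rw [autRestrict_bandEval, ← ht _ hz, bandEval_map, Category.id_comp]

/-- Any `Y` over `X.base` maps locally to `X`, so compatibility determines the value at `Y` from the
value at `X`. -/
lemma bandEval_injective (X : F.CoGrothendieck) :
    Function.Injective fun s : (bandType F).obj (op X.base) ↦ bandEval s X (𝟙 _) := by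
  intro s t h
  refine band_ext fun Y f ↦ ?_
  obtain ⟨R, hR, hR'⟩ := exists_cover_hom X Y f
  refine eq_of_locally_eq Y R hR _ _ fun Z z hz ↦ ?_
  obtain ⟨e, he⟩ := hR' z hz
  rw [autRestrict_bandEval, autRestrict_bandEval, ← he, ← Category.comp_id e.base,
    ← autRestrict_bandEval, ← autRestrict_bandEval]
  exact congrArg _ h

/-- Transport `α` to `Y` along local morphisms to `X`. By commutativity the result does not depend
on these morphisms, so it glues. -/
lemma bandEval_surjective (hF : ∀ (X : F.CoGrothendieck) (a b : Aut X.fiber), a * b = b * a)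
    (X : F.CoGrothendieck) :
    Function.Surjective fun s : (bandType F).obj (op X.base) ↦ bandEval s X (𝟙 _) := by
  intro α
  -- Quantifying over all `z` and `e`, not just those of a chosen covering, makes compatibility of
  -- the `β` formal.
  have hglue : ∀ (Y : F.CoGrothendieck) (f : Y.base ⟶ X.base), ∃ β : Aut Y.fiber,
      ∀ ⦃Z : F.CoGrothendieck⦄ (z : Z ⟶ Y) (e : Z ⟶ X), e.base = z.base ≫ f →
        autRestrict F z β = autRestrict F e α := by
    intro Y f
    obtain ⟨R, hR, hR'⟩ := exists_cover_hom X Y f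
    choose e he using hR'
    obtain ⟨β, hβ⟩ := exists_glue Y R hR (fun Z z hz ↦ autRestrict F (e z hz) α)
      fun Z' Z c z hz hz' ↦ by
        rw [← autRestrict_comp]
        refine autRestrict_eq_conj F ?_ (hF _) _
        refine Eq.trans ?_ (he _ hz').symm
        rw [Pseudofunctor.CoGrothendieck.categoryStruct_comp_base,
          Pseudofunctor.CoGrothendieck.categoryStruct_comp_base, he, Category.assoc]
    refine ⟨β, fun Z z e' he' ↦ ?_⟩
    refine eq_of_locally_eq Z _ (GrothendieckTopology.pullback_stable _ z.base hR) _ _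
      fun W v hv ↦ ?_
    rw [← autRestrict_comp, ← autRestrict_comp, hβ (v ≫ z) hv]
    refine autRestrict_eq_conj F ?_ (hF _) _
    refine (he (v ≫ z) hv).trans ?_
    rw [Pseudofunctor.CoGrothendieck.categoryStruct_comp_base,
      Pseudofunctor.CoGrothendieck.categoryStruct_comp_base, he', Category.assoc]
  choose β hβ using hglue
  have huniq : ∀ (Y : F.CoGrothendieck) (f : Y.base ⟶ X.base) (β' : Aut Y.fiber),
      (∀ ⦃Z : F.CoGrothendieck⦄ (z : Z ⟶ Y) (e : Z ⟶ X), e.base = z.base ≫ f →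
        autRestrict F z β' = autRestrict F e α) → β' = β Y f := by
    intro Y f β' h
    obtain ⟨R, hR, hR'⟩ := exists_cover_hom X Y f
    refine eq_of_locally_eq Y R hR _ _ fun Z z hz ↦ ?_
    obtain ⟨e, he⟩ := hR' z hz
    rw [h z e he, hβ Y f z e he]
  refine ⟨(⟨β, fun Y' Y g f ↦ huniq _ _ _ fun Z z e he ↦ ?_⟩ : bandSections F X.base),
    (huniq X (𝟙 _) α fun Z z e he ↦ autRestrict_eq_conj F (by simp [he]) (hF _) _).symm⟩
  rw [← autRestrict_comp]
  refine hβ _ _ _ _ ?_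
  rw [he, Pseudofunctor.CoGrothendieck.categoryStruct_comp_base, Category.assoc]

lemma bandEval_bijective (hF : ∀ (X : F.CoGrothendieck) (a b : Aut X.fiber), a * b = b * a)
    (X : F.CoGrothendieck) :
    Function.Bijective fun s : (bandType F).obj (op X.base) ↦ bandEval s X (𝟙 _) :=
  ⟨bandEval_injective X, bandEval_surjective hF X⟩

end Band

end AffGerbe

-- Affine descent for representable sheaves.

universe v' u' v

/-- Let `x` be a section over `A` of a sheaf `H` which locally generates `H`, and let `q : A ⟶ G` be
a covering morphism which identifies two points of `A` exactly if `x` takes the same value at them.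
Then `x` comes from a section over `G` which represents `H`. -/
lemma CategoryTheory.GrothendieckTopology.exists_representableBy_of_covering
    {C : Type u'} [Category.{v'} C] (J : GrothendieckTopology C) [J.Subcanonical]
    (H : Cᵒᵖ ⥤ Type w) (hH : Presieve.IsSheaf J H) {A G : C} (q : A ⟶ G)
    (hq : Sieve.generate (Presieve.singleton q) ∈ J G) (x : H.obj (op A))
    (hx : ∀ ⦃Z : C⦄ (a b : Z ⟶ A), a ≫ q = b ≫ q ↔ H.map a.op x = H.map b.op x)
    (hgen : ∀ ⦃T : C⦄ (h : H.obj (op T)), ∃ R ∈ J T, ∀ ⦃Z : C⦄ (f : Z ⟶ T), R f →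
      ∃ a : Z ⟶ A, H.map a.op x = H.map f.op h) :
    Nonempty (H.RepresentableBy G) := by
  have hG := GrothendieckTopology.Subcanonical.isSheaf_of_isRepresentable (J := J)
    (CategoryTheory.yoneda.obj G)
  -- the descended section
  obtain ⟨y, hy, -⟩ := (Presieve.isSheafFor_iff_generate _).2 (hH _ hq)
    (fun Z f hf ↦ (H.map (eqToHom (by cases hf; rfl) : Z ⟶ A).op x)) (by
      intro Y₁ Y₂ Z g₁ g₂ f₁ f₂ h₁ h₂ e
      cases h₁
      cases h₂
      simpa using (hx _ _).1 e)
  replace hy : H.map q.op y = x := by simpa using hy q (Presieve.singleton_self q)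
  have hmap : ∀ ⦃Z : C⦄ (a : Z ⟶ A), H.map (a ≫ q).op y = H.map a.op x := by
    intro Z a
    rw [op_comp, Functor.map_comp_apply, hy]
  have hloc : ∀ ⦃T : C⦄ (b : T ⟶ G), ∃ R ∈ J T, ∀ ⦃Z : C⦄ (f : Z ⟶ T), R f →
      ∃ a : Z ⟶ A, a ≫ q = f ≫ b := by
    intro T b
    refine ⟨_, J.pullback_stable b hq, fun Z f hf ↦ ?_⟩
    obtain ⟨_, a, _, ⟨⟩, h⟩ := hf
    exact ⟨a, h⟩
  refine ⟨Functor.RepresentableBy.mk (fun {T} ↦ Equiv.ofBijective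
    (fun b : T ⟶ G ↦ H.map b.op y) ⟨?_, ?_⟩) ?_⟩
  · intro b b' h
    obtain ⟨R, hR, hR'⟩ := hloc b
    obtain ⟨R₁, hR₁, hR₁'⟩ := hloc b'
    refine (hG _ (J.intersection_covering hR hR₁)).isSeparatedFor.ext fun Z f hf ↦ ?_
    obtain ⟨a, ha⟩ := hR' f hf.1
    obtain ⟨a', ha'⟩ := hR₁' f hf.2
    change f ≫ b = f ≫ b'
    rw [← ha, ← ha', hx, ← hmap, ← hmap, ha, ha', op_comp, op_comp, Functor.map_comp_apply,
      Functor.map_comp_apply]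
    exact congrArg _ h
  -- Local lifts of `h` to `A` are not unique, but their composites with `q` are, hence they glue.
  · intro h
    obtain ⟨R, hR, hR'⟩ := hgen h
    choose a ha using hR'
    obtain ⟨b, hb, -⟩ := hG R hR (fun Z f hf ↦ a f hf ≫ q) (by
      refine (Presieve.compatible_iff_sieveCompatible _).2 ?_
      intro Y Z f g hf
      change a (g ≫ f) _ ≫ q = g ≫ a f hf ≫ q
      rw [← Category.assoc, hx, ha, op_comp, op_comp, Functor.map_comp_apply,
        Functor.map_comp_apply, ha])
    refine ⟨b, (hH R hR).isSeparatedFor.ext fun Z f hf ↦ ?_⟩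
    have e : f ≫ b = a f hf ≫ q := hb f hf
    dsimp only
    rw [← Functor.map_comp_apply, ← op_comp, e, hmap, ha]
  · intro T T' f g
    change H.map (f ≫ g).op y = H.map f.op (H.map g.op y)
    rw [op_comp, Functor.map_comp_apply]

open scoped TensorProduct

namespace Algebra.TensorProduct

variable {k K V : Type*} [CommRing k] [CommRing K] [Algebra k K] [CommRing V] [Algebra k V]
  [Algebra K V] [IsScalarTower k K V]

/-- Flat descent of algebras: an algebra `V` over a flat `k`-algebra `K` with a coaction
`ρ : V → K ⊗[k] V` is the base change of its subalgebra of coinvariants. -/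
lemma bijective_lift_equalizer_of_coaction [Module.Flat k K] (ρ : V →ₐ[k] K ⊗[k] V)
    (hρ : ∀ c : K, ρ (algebraMap K V c) = c ⊗ₜ 1)
    (hcounit : ∀ v, lift (IsScalarTower.toAlgHom k K V) (AlgHom.id k V) (fun _ _ ↦ .all _ _)
      (ρ v) = v)
    (hcoassoc : ∀ v, map (AlgHom.id k K) ρ (ρ v) = map (AlgHom.id k K) includeRight (ρ v)) :
    Function.Bijective (lift (IsScalarTower.toAlgHom k K V)
      (AlgHom.equalizer ρ includeRight).val (fun _ _ ↦ .all _ _)) := by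
  set W := AlgHom.equalizer ρ (includeRight : V →ₐ[k] K ⊗[k] V)
  set μ : K ⊗[k] V →ₐ[k] V :=
    lift (IsScalarTower.toAlgHom k K V) (AlgHom.id k V) (fun _ _ ↦ .all _ _)
  set L := lift (IsScalarTower.toAlgHom k K V) W.val (fun _ _ ↦ .all _ _)
  let ι : K ⊗[k] W →ₐ[k] K ⊗[k] V := map (AlgHom.id k K) W.val
  have hι : Function.Injective ι :=
    Module.Flat.lTensor_preserves_injective_linearMap (M := K) W.val.toLinearMap
      Subtype.val_injective
  have hρL : ρ.comp L = ι := by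
    ext c
    · simpa [L, ι] using hρ c
    · have h : ρ c.1 = 1 ⊗ₜ c.1 := c.2
      simp [L, ι, h]
  refine ⟨?_, fun v ↦ ?_⟩
  -- The composite `ρ ∘ L` is the inclusion of `K ⊗ W` in `K ⊗ V`, injective by flatness.
  · refine Function.Injective.of_comp (f := ρ) ?_
    rw [← AlgHom.coe_comp, hρL]
    exact hι
  -- By flatness `K ⊗ W` is the kernel of `K ⊗ (ρ - includeRight)`. Coassociativity puts `ρ v` in
  -- it, and the counit recovers `v`.
  · have hex := Module.Flat.lTensor_exact K
      (LinearMap.exact_subtype_ker_map (ρ.toLinearMap - includeRight.toLinearMap))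
    have hz : (LinearMap.lTensor K (ρ.toLinearMap -
        (includeRight : V →ₐ[k] K ⊗[k] V).toLinearMap)) (ρ v) = 0 := by
      rw [LinearMap.lTensor_sub, LinearMap.sub_apply, sub_eq_zero]
      exact hcoassoc v
    obtain ⟨z, hz⟩ := (hex _).1 hz
    let j : LinearMap.ker (ρ.toLinearMap - (includeRight : V →ₐ[k] K ⊗[k] V).toLinearMap) →ₗ[k]
        W := LinearMap.codRestrict (Subalgebra.toSubmodule W) (Submodule.subtype _) fun c ↦ by
          have := c.2
          rw [LinearMap.mem_ker, LinearMap.sub_apply, sub_eq_zero] at this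
          exact this
    refine ⟨LinearMap.lTensor K j z, ?_⟩
    have e : ι (LinearMap.lTensor K j z) = ρ v := by
      rw [← hz]
      change (LinearMap.lTensor K W.val.toLinearMap) (LinearMap.lTensor K j z) = _
      rw [← LinearMap.comp_apply, ← LinearMap.lTensor_comp]
      rfl
    rw [← hcounit v, ← e]
    have : μ.comp ι = L := by
      ext <;> simp [μ, ι, L]
    exact (DFunLike.congr_fun this _).symm

end Algebra.TensorProduct

namespace AffGerbe

noncomputable section SpecAlg

variable (k : Type u) [Field k]

/-- The spectrum of a `k`-algebra as a scheme over `k`. -/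
abbrev specAlg (R : Type u) [CommRing R] [Algebra k R] : Sch k :=
  Over.mk (Spec.map (CommRingCat.ofHom (algebraMap k R)))

variable {k} {R S : Type u} [CommRing R] [Algebra k R] [CommRing S] [Algebra k S]

/-- The morphism of spectra attached to a morphism of `k`-algebras. -/
def specAlgMap (φ : R →ₐ[k] S) : specAlg k S ⟶ specAlg k R :=
  Over.homMk (Spec.map (CommRingCat.ofHom φ.toRingHom)) (by
    dsimp
    rw [← Spec.map_comp, ← CommRingCat.ofHom_comp]
    congr 2
    exact φ.comp_algebraMap)

lemma specAlgMap_id : specAlgMap (AlgHom.id k R) = 𝟙 (specAlg k R) := by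
  refine Over.OverMorphism.ext ?_
  exact Spec.map_id _

lemma specAlgMap_comp {S' : Type u} [CommRing S'] [Algebra k S'] (φ : R →ₐ[k] S)
    (ψ : S →ₐ[k] S') : specAlgMap (ψ.comp φ) = specAlgMap ψ ≫ specAlgMap φ := by
  refine Over.OverMorphism.ext ?_
  exact Spec.map_comp (CommRingCat.ofHom φ.toRingHom) (CommRingCat.ofHom ψ.toRingHom)

lemma specAlgMap_injective : Function.Injective (specAlgMap : (R →ₐ[k] S) → _) := by
  intro φ ψ h
  have h' := Spec.map_injective (congrArg Over.Hom.left h)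
  ext x
  exact RingHom.congr_fun (congrArg CommRingCat.Hom.hom h') x

lemma specAlgMap_surjective : Function.Surjective (specAlgMap : (R →ₐ[k] S) → _) := by
  intro f
  obtain ⟨φ, hφ⟩ := Spec.map_surjective f.left
  have hw := Over.w f
  dsimp at hw
  rw [← hφ, ← Spec.map_comp] at hw
  have hw' := congrArg CommRingCat.Hom.hom (Spec.map_injective hw)
  refine ⟨{ φ.hom with commutes' := fun r ↦ RingHom.congr_fun hw' r }, Over.OverMorphism.ext ?_⟩
  exact hφ

open Algebra.TensorProduct

lemma isPullback_specAlgMap (R S : Type u) [CommRing R] [Algebra k R] [CommRing S] [Algebra k S] :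
    IsPullback (specAlgMap (includeLeft : R →ₐ[k] R ⊗[k] S)).left
      (specAlgMap (includeRight : S →ₐ[k] R ⊗[k] S)).left (specAlg k R).hom (specAlg k S).hom :=
  isPullback_SpecMap_of_isPushout _ _ _ _ (CommRingCat.isPushout_tensorProduct k R S)

lemma specAlg_tensor_hom_ext {T : Sch k} {a b : T ⟶ specAlg k (R ⊗[k] S)}
    (h₁ : a ≫ specAlgMap includeLeft = b ≫ specAlgMap includeLeft)
    (h₂ : a ≫ specAlgMap includeRight = b ≫ specAlgMap includeRight) : a = b :=
  Over.OverMorphism.ext ((isPullback_specAlgMap R S).hom_ext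
    (congrArg Over.Hom.left h₁) (congrArg Over.Hom.left h₂))

lemma exists_specAlg_tensor_lift {T : Sch k} (a : T ⟶ specAlg k R) (b : T ⟶ specAlg k S) :
    ∃ c : T ⟶ specAlg k (R ⊗[k] S), c ≫ specAlgMap includeLeft = a ∧
      c ≫ specAlgMap includeRight = b := by
  have hP := isPullback_specAlgMap (k := k) R S
  have hab : a.left ≫ (specAlg k R).hom = b.left ≫ (specAlg k S).hom := by
    rw [Over.w, Over.w]
  refine ⟨Over.homMk (hP.lift a.left b.left hab) ?_, Over.OverMorphism.ext ?_,
    Over.OverMorphism.ext ?_⟩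
  · rw [← Over.w (specAlgMap (includeLeft : R →ₐ[k] R ⊗[k] S)), ← Category.assoc, hP.lift_fst,
      Over.w]
  · exact hP.lift_fst _ _ _
  · exact hP.lift_snd _ _ _

/-- The sieve of all schemes over `T` which admit a morphism to `S`. -/
def sieveOfHom (S T : Sch k) : Sieve T where
  arrows Z _ := Nonempty (Z ⟶ S)
  downward_closed := fun ⟨f⟩ g ↦ ⟨g ≫ f⟩

/-- It contains the pullback to `T` of the sieve generated by the faithfully flat `Spec K ⟶ Spec k`.
-/
lemma sieveOfHom_specExt_mem (K : Type u) [Field K] [Algebra k K] (T : Sch k) :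
    sieveOfHom (specExt k K) T ∈ fpqc k T := by
  have hff : (algebraMap k K).FaithfullyFlat :=
    (RingHom.faithfullyFlat_algebraMap_iff).2 inferInstance
  obtain ⟨hflat, hsurj⟩ := (flat_and_surjective_SpecMap_iff
    (CommRingCat.ofHom (algebraMap k K))).2 hff
  rw [GrothendieckTopology.mem_over_iff]
  refine GrothendieckTopology.superset_covering _ ?_ (GrothendieckTopology.pullback_stable _ T.hom
    (Scheme.Hom.generate_singleton_mem_propQCTopology (P := @Flat)
      (Spec.map (CommRingCat.ofHom (algebraMap k K))) hflat))
  rintro Z f ⟨_, a, _, ⟨⟩, h⟩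
  exact (Sieve.overEquiv_iff _ _).2 ⟨Over.homMk a h⟩

/-- A point of `Spec V` is a pair of a point of `Spec K` and a section of `H`. Replacing the first
entry while keeping the second is a descent datum, and its coinvariants define the representing
scheme. -/
lemma exists_representableBy_of_specAlg (H : (Sch k)ᵒᵖ ⥤ Type v)
    (hH : Presieve.IsSheaf (fpqc k) H) (K : Type u) [Field K] [Algebra k K]
    (V : Type u) [CommRing V] [Algebra k V] [Algebra K V] [IsScalarTower k K V]
    (x : H.obj (op (specAlg k V)))
    (hx : ∀ ⦃T : Sch k⦄ (f : T ⟶ specExt k K) (h : H.obj (op T)), ∃! a : T ⟶ specAlg k V,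
      a ≫ specAlgMap (IsScalarTower.toAlgHom k K V) = f ∧ H.map a.op x = h) :
    ∃ G : Sch k, IsAffine G.left ∧ Nonempty (H.RepresentableBy G) := by
  have huniq : ∀ ⦃T : Sch k⦄ {a b : T ⟶ specAlg k V},
      a ≫ specAlgMap (IsScalarTower.toAlgHom k K V) =
        b ≫ specAlgMap (IsScalarTower.toAlgHom k K V) →
      H.map a.op x = H.map b.op x → a = b := fun T a b h₁ h₂ ↦ (hx _ _).unique ⟨h₁, h₂⟩ ⟨rfl, rfl⟩
  -- On points, `m` sends `(s, (f, h))` to `(s, h)`; the coaction laws follow from uniqueness in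
  -- `hx`.
  obtain ⟨m, ⟨hm₁, hm₂⟩, -⟩ := hx (specAlgMap (includeLeft : K →ₐ[k] K ⊗[k] V))
    (H.map (specAlgMap (includeRight : V →ₐ[k] K ⊗[k] V)).op x)
  obtain ⟨ρ, rfl⟩ := specAlgMap_surjective m
  have hρ : ρ.comp (IsScalarTower.toAlgHom k K V) = includeLeft :=
    specAlgMap_injective (by rw [specAlgMap_comp, hm₁])
  have hcounit : (lift (IsScalarTower.toAlgHom k K V) (AlgHom.id k V) (fun _ _ ↦ .all _ _)).comp ρ =
      AlgHom.id k V := by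
    refine specAlgMap_injective (huniq ?_ ?_)
    · rw [specAlgMap_comp, Category.assoc, hm₁, ← specAlgMap_comp, ← specAlgMap_comp]
      congr 1
      ext
      simp
    · rw [specAlgMap_comp, op_comp, Functor.map_comp_apply, hm₂, ← Functor.map_comp_apply,
        ← op_comp, ← specAlgMap_comp]
      congr 4
      ext
      simp
  have hcoassoc : (map (AlgHom.id k K) ρ).comp ρ =
      (map (AlgHom.id k K) (includeRight : V →ₐ[k] K ⊗[k] V)).comp ρ := by
    refine specAlgMap_injective (huniq ?_ ?_)
    · rw [specAlgMap_comp, specAlgMap_comp, Category.assoc, Category.assoc, hm₁,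
        ← specAlgMap_comp, ← specAlgMap_comp]
      congr 1
      ext
      simp
    · rw [specAlgMap_comp, specAlgMap_comp, op_comp, op_comp, Functor.map_comp_apply,
        Functor.map_comp_apply, hm₂, ← Functor.map_comp_apply, ← Functor.map_comp_apply,
        ← op_comp, ← op_comp, ← specAlgMap_comp, ← specAlgMap_comp]
      have e₁ : (map (AlgHom.id k K) ρ).comp includeRight = includeRight.comp ρ := by
        ext
        simp
      have e₂ : (map (AlgHom.id k K) (includeRight : V →ₐ[k] K ⊗[k] V)).comp includeRight =
          includeRight.comp includeRight := by
        ext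
        simp
      rw [e₁, e₂, specAlgMap_comp, specAlgMap_comp, op_comp, op_comp, Functor.map_comp_apply,
        Functor.map_comp_apply, hm₂]
  let W := AlgHom.equalizer ρ (includeRight : V →ₐ[k] K ⊗[k] V)
  have hbij := bijective_lift_equalizer_of_coaction ρ (fun c ↦ AlgHom.congr_fun hρ c)
    (fun v ↦ AlgHom.congr_fun hcounit v) (fun v ↦ AlgHom.congr_fun hcoassoc v)
  let E := AlgEquiv.ofBijective _ hbij
  let q : specAlg k V ⟶ specAlg k W := specAlgMap W.val
  have hE₁ : (E : K ⊗[k] W →ₐ[k] V).comp includeLeft = IsScalarTower.toAlgHom k K V := by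
    ext
    simp [E]
  have hE₂ : (E : K ⊗[k] W →ₐ[k] V).comp includeRight = W.val := by
    ext
    simp [E]
  have hEi : specAlgMap (E.symm : V →ₐ[k] K ⊗[k] W) ≫ specAlgMap (E : K ⊗[k] W →ₐ[k] V) = 𝟙 _ := by
    rw [← specAlgMap_comp, ← specAlgMap_id]
    congr 1
    ext <;> simp
  have hEi' : specAlgMap (E : K ⊗[k] W →ₐ[k] V) ≫ specAlgMap (E.symm : V →ₐ[k] K ⊗[k] W) = 𝟙 _ := by
    rw [← specAlgMap_comp, ← specAlgMap_id]
    congr 1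
    ext
    simp
  have hext : ∀ ⦃T : Sch k⦄ {a b : T ⟶ specAlg k V},
      a ≫ specAlgMap (IsScalarTower.toAlgHom k K V) =
        b ≫ specAlgMap (IsScalarTower.toAlgHom k K V) → a ≫ q = b ≫ q → a = b := by
    intro T a b h₁ h₂
    rw [← hE₁, specAlgMap_comp, ← Category.assoc, ← Category.assoc] at h₁
    rw [show q = _ from congrArg specAlgMap hE₂.symm, specAlgMap_comp, ← Category.assoc,
      ← Category.assoc] at h₂
    have := specAlg_tensor_hom_ext h₁ h₂
    rw [← Category.comp_id a, ← Category.comp_id b, ← hEi', reassoc_of% this]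
  have hmq : specAlgMap ρ ≫ q = specAlgMap includeRight ≫ q := by
    rw [← specAlgMap_comp, ← specAlgMap_comp]
    congr 1
    ext v
    exact v.2
  -- `a` and `b` have the same image in the quotient iff `a` is the translate of `b`
  have htrans : ∀ ⦃T : Sch k⦄ (a b : T ⟶ specAlg k V), ∃ c : T ⟶ specAlg k V,
      c ≫ specAlgMap (IsScalarTower.toAlgHom k K V) =
        a ≫ specAlgMap (IsScalarTower.toAlgHom k K V) ∧ c ≫ q = b ≫ q ∧
          H.map c.op x = H.map b.op x := by
    intro T a b
    obtain ⟨c, hc₁, hc₂⟩ :=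
      exists_specAlg_tensor_lift (a ≫ specAlgMap (IsScalarTower.toAlgHom k K V)) b
    refine ⟨c ≫ specAlgMap ρ, ?_, ?_, ?_⟩
    · rw [Category.assoc, hm₁, hc₁]
    · rw [Category.assoc, hmq, reassoc_of% hc₂]
    · rw [op_comp, Functor.map_comp_apply, hm₂, ← Functor.map_comp_apply, ← op_comp, hc₂]
  refine ⟨specAlg k W, inferInstanceAs (IsAffine (Spec _)),
    (fpqc k).exists_representableBy_of_covering H hH q ?_ x (fun Z a b ↦ ?_) fun T h ↦ ?_⟩
  -- A point of `Spec W` over a scheme with a morphism to `Spec K` lifts to `Spec (K ⊗ W) ≅ Spec V`.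
  · refine GrothendieckTopology.superset_covering _ ?_
      (sieveOfHom_specExt_mem K (specAlg k W))
    rintro Z f ⟨s⟩
    obtain ⟨c, -, hc⟩ := exists_specAlg_tensor_lift s f
    refine ⟨_, c ≫ specAlgMap (E.symm : V →ₐ[k] K ⊗[k] W), q, Presieve.singleton_self q, ?_⟩
    rw [show q = _ from congrArg specAlgMap hE₂.symm, specAlgMap_comp, Category.assoc,
      reassoc_of% hEi, hc]
  · obtain ⟨c, hc₁, hc₂, hc₃⟩ := htrans a b
    refine ⟨fun h ↦ ?_, fun h ↦ ?_⟩
    · rw [← hext hc₁ (hc₂.trans h.symm), hc₃]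
    · rw [← huniq hc₁ (hc₃.trans h.symm), hc₂]
  · refine ⟨_, sieveOfHom_specExt_mem K T, ?_⟩
    rintro Z f ⟨s⟩
    obtain ⟨a, ⟨-, ha⟩, -⟩ := hx s (H.map f.op h)
    exact ⟨a, ha⟩

lemma exists_specAlg_iso {K : Type u} [Field K] [Algebra k K] {A : Sch k} (π : A ⟶ specExt k K)
    [IsAffineHom π.left] :
    ∃ (V : Type u) (_ : CommRing V) (_ : Algebra k V) (_ : Algebra K V) (_ : IsScalarTower k K V)
      (e : specAlg k V ≅ A), e.hom ≫ π = specAlgMap (IsScalarTower.toAlgHom k K V) := by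
  have : IsAffine (specExt k K).left := inferInstanceAs (IsAffine (Spec _))
  have : IsAffine A.left := isAffine_of_isAffineHom π.left
  obtain ⟨p, hp⟩ := Spec.map_surjective (A.left.isoSpec.inv ≫ π.left)
  let V : Type u := Γ(A.left, ⊤)
  let : Algebra K V := p.hom.toAlgebra
  let : Algebra k V := (p.hom.comp (algebraMap k K)).toAlgebra
  refine ⟨V, inferInstance, inferInstance, inferInstance, .of_algebraMap_eq' rfl,
    Over.isoMk A.left.isoSpec.symm ?_, Over.OverMorphism.ext hp.symm⟩
  have h : A.left.isoSpec.inv ≫ A.hom =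
      Spec.map p ≫ Spec.map (CommRingCat.ofHom (algebraMap k K)) := by
    rw [hp, Category.assoc]
    exact congrArg (A.left.isoSpec.inv ≫ ·) (Over.w π).symm
  rw [← Spec.map_comp] at h
  exact h

/-- A sheaf whose restriction to the spectrum of an extension `K` of `k` is represented by an affine
scheme over `K` is represented by an affine scheme over `k`. -/
lemma exists_representableBy_of_specExt (H : (Sch k)ᵒᵖ ⥤ Type v)
    (hH : Presieve.IsSheaf (fpqc k) H) (K : Type u) [Field K] [Algebra k K] {A : Sch k}
    (π : A ⟶ specExt k K) [IsAffineHom π.left] (x : H.obj (op A))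
    (hx : ∀ ⦃T : Sch k⦄ (f : T ⟶ specExt k K) (h : H.obj (op T)), ∃! a : T ⟶ A,
      a ≫ π = f ∧ H.map a.op x = h) :
    ∃ G : Sch k, IsAffine G.left ∧ Nonempty (H.RepresentableBy G) := by
  obtain ⟨V, _, _, _, _, e, he⟩ := exists_specAlg_iso π
  refine exists_representableBy_of_specAlg H hH K V (H.map e.hom.op x) fun T f h ↦ ?_
  obtain ⟨a, ⟨ha₁, ha₂⟩, ha⟩ := hx f h
  refine ⟨a ≫ e.inv, ⟨?_, ?_⟩, ?_⟩
  · simp [← he, ha₁]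
  · rw [← Functor.map_comp_apply, ← op_comp, Category.assoc, e.inv_hom_id, Category.comp_id, ha₂]
  · rintro b ⟨hb₁, hb₂⟩
    rw [← ha (b ≫ e.hom) ⟨by rw [Category.assoc, he, hb₁], ?_⟩, Category.assoc, e.hom_inv_id,
      Category.comp_id]
    rw [op_comp, Functor.map_comp_apply, hb₂]

end SpecAlg

end AffGerbe

open MonoidalCategory CartesianMonoidalCategory MonObj in
lemma CategoryTheory.GrpObj.ofRepresentableBy_homEquiv_mul {C : Type*} [Category* C]
    [CartesianMonoidalCategory C] (X : C) (F : Cᵒᵖ ⥤ GrpCat.{w})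
    (α : (F ⋙ forget _).RepresentableBy X) {Y : C} (f g : Y ⟶ X) :
    letI := GrpObj.ofRepresentableBy X F α
    α.homEquiv (f * g) = (show F.obj (op Y) from α.homEquiv f) * α.homEquiv g := by
  let s : F.obj (op (X ⊗ X)) := α.homEquiv (fst X X)
  let t : F.obj (op (X ⊗ X)) := α.homEquiv (snd X X)
  have hs : F.map (lift f g).op s = α.homEquiv f :=
    (α.homEquiv_comp (lift f g) (fst X X)).symm.trans (congrArg _ (lift_fst f g))
  have ht : F.map (lift f g).op t = α.homEquiv g :=
    (α.homEquiv_comp (lift f g) (snd X X)).symm.trans (congrArg _ (lift_snd f g))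
  change α.homEquiv (lift f g ≫ α.homEquiv.symm (s * t)) = _
  rw [α.homEquiv_comp, Equiv.apply_symm_apply, ← hs, ← ht]
  exact map_mul (F.map (lift f g).op).hom s t

/-! ### The two implications. -/

namespace AffGerbe

variable {k : Type u} [Field k] {F : FibCat.{u, w} k}

noncomputable section

/-- Commutation can be checked locally, where the object is isomorphic to a pullback of `ξ`. -/
lemma aut_mul_comm_of_isAbelianAut [IsGerbe F] {S : Sch k} {ξ : Fib F S} (hξ : IsAbelianAut ξ)
    (hS : ∀ T, sieveOfHom S T ∈ fpqc k T) (X : F.CoGrothendieck) (a b : Aut X.fiber) :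
    a * b = b * a := by
  refine eq_of_locally_eq X _ (hS X.base) _ _ fun Z z ⟨f⟩ ↦ ?_
  obtain ⟨R, hR, hR'⟩ := exists_cover_hom ⟨S, ξ⟩ Z f
  refine eq_of_locally_eq Z R hR _ _ fun W v hv ↦ ?_
  obtain ⟨e, -⟩ := hR' v hv
  refine (asIso e.fiber).conjAut.injective ?_
  simp only [map_mul]
  exact hξ e.base _ _

lemma isAbelianAut_of_aut_mul_comm
    (hF : ∀ (X : F.CoGrothendieck) (a b : Aut X.fiber), a * b = b * a) {T : Sch k} (ξ : Fib F T) :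
    IsAbelianAut ξ :=
  fun _ f a b ↦ hF ⟨_, pull f ξ⟩ a b

lemma aut_mul_comm_of_inertiaDescends [IsFiberedInGroupoids F] (h : InertiaDescends F)
    (X : F.CoGrothendieck) (a b : Aut X.fiber) : a * b = b * a := by
  obtain ⟨G, _, -, ⟨θ⟩⟩ := h
  have key : ∀ {f g : X ⟶ X}, f.base = g.base → autRestrict F f a = autRestrict F g a := by
    intro f g hfg
    have hn : ∀ (f : X ⟶ X) (y : (pullbackGroup F G).obj (op X)),
        autRestrict F f (θ.hom.app (op X) y) = θ.hom.app (op X) ((pullbackGroup F G).map f.op y) :=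
      fun f y ↦ (ConcreteCategory.congr_hom (θ.hom.naturality f.op) y).symm
    obtain ⟨y, hy⟩ : ∃ y, θ.hom.app (op X) y = a :=
      ⟨θ.inv.app (op X) a, ConcreteCategory.congr_hom (θ.inv_hom_id_app (op X)) a⟩
    rw [← hy, hn, hn]
    exact congrArg (fun p : X.base ⟶ X.base ↦
      θ.hom.app (op X) ((yonedaGrpObj G).map p.op y)) hfg
  -- This is `b` as a vertical endomorphism of `X`; the fibre of `𝟙 X` identifies `X.fiber` with its
  -- pullback along the identity.
  let c : X ⟶ X := ⟨(𝟙 X : X ⟶ X).base, b.hom ≫ (𝟙 X : X ⟶ X).fiber⟩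
  have h₁ := autRestrict_hom_comp c a
  have h₂ := autRestrict_hom_comp (𝟙 X) a
  rw [key (show c.base = (𝟙 X : X ⟶ X).base from rfl), autRestrict_id] at h₁
  rw [autRestrict_id] at h₂
  have h₃ : (a.hom ≫ b.hom) ≫ (𝟙 X : X ⟶ X).fiber = (b.hom ≫ a.hom) ≫ (𝟙 X : X ⟶ X).fiber := by
    rw [Category.assoc, Category.assoc, h₂, ← Category.assoc b.hom]
    exact h₁
  exact Iso.ext ((cancel_mono _).1 h₃).symm

variable (k) in
/-- The final object `Spec k` has no fpqc covering by empty schemes. -/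
lemma exists_nonempty_of_mem_fpqc (R : Sieve (specAlg k k)) (hR : R ∈ fpqc k (specAlg k k)) :
    ∃ (U : Sch k) (f : U ⟶ specAlg k k), R f ∧ Nonempty U.left := by
  by_contra! hempty
  have hs := (GrothendieckTopology.Subcanonical.isSheaf_of_isRepresentable (J := fpqc k)
    (CategoryTheory.yoneda.obj (specAlg k (k × k))) R hR).isSeparatedFor
  -- On a covering by empty schemes the two distinct `k`-points of `Spec (k × k)` would agree.
  have h : specAlgMap (AlgHom.fst k k k) = specAlgMap (AlgHom.snd k k k) := by
    refine hs.ext fun U f hf ↦ Over.OverMorphism.ext ?_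
    have := hempty U f hf
    exact isInitialOfIsEmpty.hom_ext _ _
  have h' := AlgHom.congr_fun (specAlgMap_injective h) (1, 0)
  simp at h'

variable (F) in
lemma exists_object_over_field [IsGerbe F] :
    ∃ (K : Type u) (_ : Field K) (_ : Algebra k K), Nonempty (Fib F (specExt k K)) := by
  obtain ⟨R, hR, hR'⟩ := IsGerbe.locally_nonempty (F := F) (specAlg k k)
  obtain ⟨U, f, hf, ⟨x⟩⟩ := exists_nonempty_of_mem_fpqc k R hR
  obtain ⟨ξ⟩ := hR' f hf
  obtain ⟨p, hp⟩ := Spec.map_surjective (U.left.fromSpecResidueField x ≫ U.hom)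
  let : Algebra k (U.left.residueField x) := p.hom.toAlgebra
  let g : specExt k (U.left.residueField x) ⟶ U :=
    Over.homMk (U.left.fromSpecResidueField x) hp.symm
  exact ⟨U.left.residueField x, inferInstance, inferInstance, ⟨pull g ξ⟩⟩

lemma isAbelian_of_inertiaDescends [IsGerbe F] (h : InertiaDescends F) : IsAbelian F := by
  obtain ⟨K, _, _, ⟨ξ⟩⟩ := exists_object_over_field F
  exact ⟨K, _, _, ξ, isAbelianAut_of_aut_mul_comm (aut_mul_comm_of_inertiaDescends h) ξ⟩

/-- The section `x` is the universal automorphism of `ξ` over `I`, spread out to the band;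
evaluation at pullbacks of `ξ` turns its universal property into that of `I`. -/
lemma exists_band_representableBy_over [IsGerbe F]
    (hF : ∀ (X : F.CoGrothendieck) (a b : Aut X.fiber), a * b = b * a) {S : Sch k} (ξ : Fib F S)
    (I : Over S) (r : (F.presheafHom ξ ξ).RepresentableBy I) :
    ∃ x : (bandType F).obj (op I.left), ∀ ⦃T : Sch k⦄ (f : T ⟶ S) (h : (bandType F).obj (op T)),
      ∃! a : T ⟶ I.left, a ≫ I.hom = f ∧ (bandType F).map a.op x = h := by
  let X : F.CoGrothendieck := ⟨S, ξ⟩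
  let α : Aut (pull I.hom ξ) := asIso (show pull I.hom ξ ⟶ pull I.hom ξ from r.homEquiv (𝟙 I))
  obtain ⟨x, hx⟩ := bandEval_surjective hF (pullObj X I.hom) α
  refine ⟨x, fun T f h ↦ ?_⟩
  let β : Aut (pull f ξ) := bandEval h (pullObj X f) (𝟙 _)
  have key : ∀ a : Over.mk f ⟶ I, (bandType F).map a.left.op x = h ↔ r.homEquiv a = β.hom := by
    intro a
    have h₁ : r.homEquiv a =
        (autRestrict F (pullComp X I.hom a.left f (Over.w a)) α).hom := by
      rw [r.homEquiv_eq]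
      exact pullHom_eq_autRestrict X I.hom a.left f (Over.w a) α
    have h₂ : autRestrict F (pullComp X I.hom a.left f (Over.w a)) α =
        bandEval ((bandType F).map a.left.op x) (pullObj X f) (𝟙 _) := by
      rw [← hx, autRestrict_bandEval, bandEval_map]
      exact congrArg _ ((Category.comp_id a.left).trans (Category.id_comp a.left).symm)
    rw [h₁, h₂]
    exact ⟨fun h ↦ by rw [h], fun h ↦ bandEval_injective (pullObj X f) (Iso.ext h)⟩
  refine ⟨(r.homEquiv.symm β.hom : Over.mk f ⟶ I).left, ⟨Over.w _, (key _).2 ?_⟩, ?_⟩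
  · exact r.homEquiv.apply_symm_apply _
  · rintro a ⟨rfl, ha⟩
    have := (key (Over.homMk a)).1 ha
    rw [← this, Equiv.symm_apply_apply]
    rfl

lemma inertiaDescends_of_isAbelian [IsAffineGerbe F] (h : IsAbelian F) : InertiaDescends F := by
  obtain ⟨K, _, _, ξ, hξ⟩ := h
  have hF := aut_mul_comm_of_isAbelianAut hξ (sieveOfHom_specExt_mem K)
  obtain ⟨I, _, ⟨r⟩⟩ := IsAffineGerbe.hasAffineDiagonal _ ξ ξ
  obtain ⟨x, hx⟩ := exists_band_representableBy_over hF ξ I r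
  obtain ⟨G, hG, ⟨r'⟩⟩ := exists_representableBy_of_specExt _ (isSheaf_bandType F) K I.hom x hx
  -- The group law on `G` is that of the band, so evaluating the section attached to a point of `G`
  -- is a homomorphism to the inertia.
  let := GrpObj.ofRepresentableBy G (band F) r'
  refine ⟨G, inferInstance, hG, ⟨NatIso.ofComponents (fun X ↦ MulEquiv.toGrpIso
    { toEquiv := r'.homEquiv.trans (Equiv.ofBijective _ (bandEval_bijective hF X.unop))
      map_mul' := fun f g ↦ ?_ }) ?_⟩⟩
  · exact congrArg (fun s ↦ bandEval s X.unop (𝟙 _))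
      (GrpObj.ofRepresentableBy_homEquiv_mul G (band F) r' f g)
  · intro X Y f
    refine GrpCat.hom_ext (MonoidHom.ext fun (g : X.unop.base ⟶ G) ↦ ?_)
    change bandEval (r'.homEquiv (f.unop.base ≫ g)) Y.unop (𝟙 _) =
      autRestrict F f.unop (bandEval (r'.homEquiv g) X.unop (𝟙 _))
    rw [r'.homEquiv_comp, autRestrict_bandEval, bandEval_map, Category.id_comp, Category.comp_id]

end

end AffGerbe

theorem propositionA3 {k : Type u} [Field k] (F : AffGerbe.FibCat.{u, w} k)
    [AffGerbe.IsAffineGerbe F] :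
    AffGerbe.IsAbelian F ↔ AffGerbe.InertiaDescends F :=
  ⟨AffGerbe.inertiaDescends_of_isAbelian, AffGerbe.isAbelian_of_inertiaDescends⟩
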